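/- Let $a, g_u, b, c, g_v, d$ be positive real numbers with $a+g_u+b=1$ and $c+g_v+d=1$. Consider the $2$-vertex directed graph iterated function system on $\mathbb{R}$ with vertices $u,v$ and edges $e_1$ (a loop at $u$), $e_2$ (from $u$ to $v$), $e_3$ (a loop at $v$), $e_4$ (from $v$ to $u$), carrying the non-reflecting contracting similarities $$S_{e_1}(x)=ax,\qquad S_{e_2}(x)=bx+a+g_u,\qquad S_{e_3}(x)=cx,\qquad S_{e_4}(x)=dx+c+g_v .$$ Its attractor is the unique pair $(F_u,F_v)$ of non-empty compact subsets of $\mathbb{R}$ with $$F_u=S_{e_1}(F_u)\cup S_{e_2}(F_v),\qquad F_v=S_{e_3}(F_v)\cup S_{e_4}(F_u).$$ Suppose that $F_u\neq F_v$. Then neither $F_u$ nor $F_v$ is the attractor of a standard IFS on $\mathbb{R}$ whose defining similarities do not reflect, with or without separation conditions. That is, for $A=F_u$ and for $A=F_v$, there is no finite family $T_1,\dots,T_n$ of maps $T_i(x)=r_ix+t_i$ with $0<r_i<1$ and $t_i\in\mathbb{R}$ such that $A=\bigcup_{i=1}^n T_i(A)$; the sets $T_i(A)$ may overlap. -/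

import Mathlib

/-- A self-similar directed graph iterated function system on `ℝ` with finite vertex set `V` and
finite set `E` of directed edges. Each edge `e` runs from `init e` to `term e` and carries a
contracting similarity `map e : ℝ → ℝ` of ratio `ratio e`, `0 < ratio e < 1`. The map `map e` goes
in the direction opposite to the edge: it sends the line at `term e` to the line at `init e`.
No separation condition is imposed. -/
structure SelfSimilarIFS (V E : Type) [Finite V] [Finite E] where
  init : E → V
  term : E → V
  ratio : E → ℝ
  ratio_pos : ∀ e, 0 < ratio e
  ratio_lt_one : ∀ e, ratio e < 1
  map : E → ℝ → ℝ
  similarity : ∀ e x y, |map e x - map e y| = ratio e * |x - y|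

namespace SelfSimilarIFS

variable {V E : Type} [Finite V] [Finite E]

/-- None of the defining similarities reverses the orientation of the line. -/
def NonReflecting (Φ : SelfSimilarIFS V E) : Prop :=
  ∀ e, StrictMono (Φ.map e)

/-- `F` is the attractor of `Φ`: the (unique) list of non-empty compact subsets of `ℝ`, indexed by
the vertices, with `F u` the union of `S_e (F (t e))` over the edges `e` that leave `u`. -/
def IsAttractor (Φ : SelfSimilarIFS V E) (F : V → Set ℝ) : Prop :=
  (∀ u, (F u).Nonempty ∧ IsCompact (F u)) ∧
    ∀ u, F u = ⋃ e ∈ {e : E | Φ.init e = u}, Φ.map e '' F (Φ.term e)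

end SelfSimilarIFS

/-- `A` is the attractor of a standard IFS on `ℝ`: a `1`-vertex self-similar IFS given by finitely
many non-reflecting contracting similarities, with no separation condition. -/
def IsStandardIFSAttractor (A : Set ℝ) : Prop :=
  ∃ (n : ℕ) (Φ : SelfSimilarIFS Unit (Fin n)),
    Φ.NonReflecting ∧ Φ.IsAttractor (fun _ => A)

/-- The parameters of the `2`-vertex system: the lengths of the level-1 intervals and of the
level-1 gaps at the two vertices. At the vertex `u` the unit interval is cut, from left to right,
into an interval of length `a`, a gap of length `gu` and an interval of length `b`; at the vertex
`v` into an interval of length `c`, a gap of length `gv` and an interval of length `d`. -/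
structure TwoVertexParams where
  a : ℝ
  gu : ℝ
  b : ℝ
  c : ℝ
  gv : ℝ
  d : ℝ
  a_pos : 0 < a
  gu_pos : 0 < gu
  b_pos : 0 < b
  c_pos : 0 < c
  gv_pos : 0 < gv
  d_pos : 0 < d
  sum_u : a + gu + b = 1
  sum_v : c + gv + d = 1

/-- The two vertices. -/
inductive TwoVertex : Type
  | u
  | v

/-- The four edges. -/
inductive FourEdge : Type
  | e₁
  | e₂
  | e₃
  | e₄

instance : Finite TwoVertex :=
  Finite.of_surjective (fun i : Fin 2 => if i = 0 then TwoVertex.u else TwoVertex.v) (by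
    intro x
    cases x
    · exact ⟨0, rfl⟩
    · exact ⟨1, rfl⟩)

instance : Finite FourEdge :=
  Finite.of_surjective
    (![FourEdge.e₁, FourEdge.e₂, FourEdge.e₃, FourEdge.e₄] : Fin 4 → FourEdge) (by
    intro x
    cases x
    · exact ⟨0, rfl⟩
    · exact ⟨1, rfl⟩
    · exact ⟨2, rfl⟩
    · exact ⟨3, rfl⟩)

namespace TwoVertexParams

/-- The initial vertices: `e₁` and `e₂` leave `u`, while `e₃` and `e₄` leave `v`. -/
def init : FourEdge → TwoVertex
  | .e₁ => .u
  | .e₂ => .u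
  | .e₃ => .v
  | .e₄ => .v

/-- The terminal vertices: `e₁` is a loop at `u`, `e₂` goes from `u` to `v`, `e₃` is a loop at `v`
and `e₄` goes from `v` to `u`. -/
def term : FourEdge → TwoVertex
  | .e₁ => .u
  | .e₂ => .v
  | .e₃ => .v
  | .e₄ => .u

/-- The contraction ratios. -/
def ratio (P : TwoVertexParams) : FourEdge → ℝ
  | .e₁ => P.a
  | .e₂ => P.b
  | .e₃ => P.c
  | .e₄ => P.d

/-- The images of `0`. -/
def shift (P : TwoVertexParams) : FourEdge → ℝ
  | .e₁ => 0
  | .e₂ => P.a + P.gu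
  | .e₃ => 0
  | .e₄ => P.c + P.gv

theorem ratio_pos (P : TwoVertexParams) (e : FourEdge) : 0 < P.ratio e := by
  cases e
  · exact P.a_pos
  · exact P.b_pos
  · exact P.c_pos
  · exact P.d_pos

theorem ratio_lt_one (P : TwoVertexParams) (e : FourEdge) : P.ratio e < 1 := by
  have := P.a_pos
  have := P.gu_pos
  have := P.b_pos
  have := P.c_pos
  have := P.gv_pos
  have := P.d_pos
  have := P.sum_u
  have := P.sum_v
  cases e <;> simp only [ratio] <;> linarith

/-- The `2`-vertex IFS on the unit interval with
`S_{e₁} x = a x`, `S_{e₂} x = b x + a + gu`, `S_{e₃} x = c x`, `S_{e₄} x = d x + c + gv`. -/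
def toIFS (P : TwoVertexParams) : SelfSimilarIFS TwoVertex FourEdge where
  init := init
  term := term
  ratio := P.ratio
  ratio_pos := P.ratio_pos
  ratio_lt_one := P.ratio_lt_one
  map := fun e x => P.ratio e * x + P.shift e
  similarity := by
    intro e x y
    rw [add_sub_add_right_eq_sub, ← mul_sub, abs_mul, abs_of_pos (P.ratio_pos e)]

end TwoVertexParams

/-!
Write `A`, `B` for the two components of the attractor, so that `A = a A ∪ (1 - b + b B)` and
`B = c B ∪ (1 - d + d A)`. Both lie in `[0, 1]` and contain `0` and `1`, and every gap of `A` or `B`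
is the image of one of the main gaps `(a, 1 - b)`, `(c, 1 - d)` under a cylinder map. By symmetry it
is enough to show that `A` is not a standard attractor.

Suppose `A` is a finite union of contracted copies `Tᵢ A`, and look at the point `1 - b`, which has
the main gap of `A` on its left. A copy containing this point has there either its own left end or
the right end of one of its gaps. If that gap were an image of `(a, 1 - b)`, it would be shorter than
the main gap of `A`, which it has to contain; so it is an image of `(c, 1 - d)`, and in all cases
`Tᵢ A` looks like a left-aligned scaled copy of `A` to the right of `1 - b`
(`TwoPieceSystem.local_copy`). Hence, near `0`, the set `B` is covered by finitely many sets
`ρᵢ A ⊆ B`.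

This is impossible when `A ≠ B` (`TwoPieceSystem.not_locally_covered`). The tool is the endpoint
ratio `p / q` of a gap `(p, q)`. Scaling preserves it and shifting to the right raises it, so its
minimum is the smaller of the ratios of the two main gaps. A set `ρ A` that lies in `B` and contains
an end of the gap `cⁿ (c, 1 - d)` of `B` has a gap around that gap, with a ratio at most as large.

* If `c / (1 - d) ≤ a / (1 - b)`, take the left end `cⁿ⁺¹`. The gap of `ρ A` there has minimal ratio,
  so it is `ρ aᵏ (a, 1 - b)`, and `cⁿ⁺¹ A = ρ aᵏ⁺¹ A ⊆ B`, whence `A ⊆ B`. Comparing gaps of minimal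
  ratio as seen from the common right end `1`, one finds that `A ⊆ B` forces `a = c` and `b = d`
  (`TwoPieceSystem.eq_of_subset`), and then `A = B`.
* If `a / (1 - b) < c / (1 - d)`, take the right end `cⁿ (1 - d)`, near which `B` looks like `A` near
  `0`. If the gap of `ρ A` there is an image of `(a, 1 - b)`, a scaled copy of `B` with left end `0`
  lies in `A`, although the ratios of the gaps of `B` all exceed the minimal ratio of `A`. If it is an
  image of `(c, 1 - d)`, the cylinder containing it is a copy of `B` too long to fit to the right
  of `0`.
-/

open Set Filter Topology

/-- `A` and `B` are closed subsets of `[0, 1]` containing both endpoints, with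
`A = a A ∪ (1 - b + b B)` and `B = c B ∪ (1 - d + d A)`, where the two pieces of each set are
separated by a gap. The notion is symmetric under exchanging `(a, b, A)` with `(c, d, B)`. -/
structure TwoPieceSystem (a b c d : ℝ) (A B : Set ℝ) : Prop where
  a_pos : 0 < a
  b_pos : 0 < b
  c_pos : 0 < c
  d_pos : 0 < d
  hab : a + b < 1
  hcd : c + d < 1
  closed_A : IsClosed A
  closed_B : IsClosed B
  sub_A : A ⊆ Icc 0 1
  sub_B : B ⊆ Icc 0 1
  zero_A : (0 : ℝ) ∈ A
  zero_B : (0 : ℝ) ∈ B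
  one_A : (1 : ℝ) ∈ A
  one_B : (1 : ℝ) ∈ B
  mem_A : ∀ x, x ∈ A ↔ (∃ y ∈ A, x = a * y) ∨ ∃ y ∈ B, x = 1 - b + b * y
  mem_B : ∀ x, x ∈ B ↔ (∃ y ∈ B, x = c * y) ∨ ∃ y ∈ A, x = 1 - d + d * y

/-- `(p, q)` is a gap of `X`: a bounded component of the complement, when `X` is closed. -/
structure IsGap (X : Set ℝ) (p q : ℝ) : Prop where
  lt : p < q
  left_mem : p ∈ X
  right_mem : q ∈ X
  not_mem : ∀ x ∈ X, p < x → x < q → False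

/-- An open interval that misses `X` and has points of `X` on both sides lies in a gap of `X`. -/
theorem exists_isGap_of_disjoint {X : Set ℝ} (hX : IsClosed X) {s t x y : ℝ} (hst : s < t)
    (hx : x ∈ X) (hxs : x ≤ s) (hy : y ∈ X) (hty : t ≤ y)
    (h : ∀ z ∈ X, s < z → z < t → False) :
    ∃ p q, IsGap X p q ∧ p ≤ s ∧ t ≤ q := by
  have hL : sSup (X ∩ Iic s) ∈ X ∩ Iic s :=
    (hX.inter isClosed_Iic).csSup_mem ⟨x, hx, hxs⟩ ⟨s, fun z hz => hz.2⟩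
  have hR : sInf (X ∩ Ici t) ∈ X ∩ Ici t :=
    (hX.inter isClosed_Ici).csInf_mem ⟨y, hy, hty⟩ ⟨t, fun z hz => hz.2⟩
  refine ⟨_, _, ⟨lt_of_le_of_lt hL.2 (lt_of_lt_of_le hst hR.2), hL.1, hR.1, ?_⟩, hL.2, hR.2⟩
  intro z hz h1 h2
  refine h z hz ?_ ?_
  · by_contra! hle
    exact absurd (le_csSup ⟨s, fun z hz => hz.2⟩ (show z ∈ X ∩ Iic s from ⟨hz, hle⟩)) (not_le.2 h1)
  · by_contra! hle
    exact absurd (csInf_le ⟨t, fun z hz => hz.2⟩ (show z ∈ X ∩ Ici t from ⟨hz, hle⟩)) (not_le.2 h2)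

namespace TwoPieceSystem

variable {a b c d : ℝ} {A B : Set ℝ}

theorem swap (h : TwoPieceSystem a b c d A B) : TwoPieceSystem c d a b B A :=
  ⟨h.c_pos, h.d_pos, h.a_pos, h.b_pos, h.hcd, h.hab, h.closed_B, h.closed_A, h.sub_B, h.sub_A,
    h.zero_B, h.zero_A, h.one_B, h.one_A, h.mem_B, h.mem_A⟩

/-! ### Cylinders -/

theorem mul_mem_iff (h : TwoPieceSystem a b c d A B) {x : ℝ} (hx : x ≤ 1) :
    a * x ∈ A ↔ x ∈ A := by
  have ha := h.a_pos
  have hb := h.b_pos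
  have hab := h.hab
  refine ⟨fun hm => ?_, fun hm => (h.mem_A _).2 (Or.inl ⟨x, hm, rfl⟩)⟩
  rcases (h.mem_A _).1 hm with ⟨y, hy, e⟩ | ⟨y, hy, e⟩
  · rwa [mul_left_cancel₀ ha.ne' e]
  · have := (h.sub_B hy).1
    nlinarith

theorem add_mul_mem_iff (h : TwoPieceSystem a b c d A B) {x : ℝ} (hx : 0 ≤ x) :
    1 - b + b * x ∈ A ↔ x ∈ B := by
  have ha := h.a_pos
  have hb := h.b_pos
  have hab := h.hab
  refine ⟨fun hm => ?_, fun hm => (h.mem_A _).2 (Or.inr ⟨x, hm, rfl⟩)⟩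
  rcases (h.mem_A _).1 hm with ⟨y, hy, e⟩ | ⟨y, hy, e⟩
  · have := (h.sub_A hy).2
    nlinarith
  · rwa [mul_left_cancel₀ hb.ne' (add_left_cancel e)]

theorem pow_mul_mem_iff (h : TwoPieceSystem a b c d A B) (n : ℕ) {x : ℝ} (hx0 : 0 ≤ x)
    (hx : x ≤ 1) : a ^ n * x ∈ A ↔ x ∈ A := by
  have ha := h.a_pos
  have ha1 : a ≤ 1 := by linarith [h.b_pos, h.hab]
  induction n with
  | zero => simp
  | succ n ih =>
    rw [pow_succ', mul_assoc]
    exact (h.mul_mem_iff (mul_le_one₀ (pow_le_one₀ ha.le ha1) hx0 hx)).trans ih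

theorem left_end_mem (h : TwoPieceSystem a b c d A B) : a ∈ A := by
  have := (h.mul_mem_iff le_rfl).2 h.one_A
  rwa [mul_one] at this

theorem right_start_mem (h : TwoPieceSystem a b c d A B) : 1 - b ∈ A := by
  have := (h.add_mul_mem_iff le_rfl).2 h.zero_B
  rwa [mul_zero, add_zero] at this

/-- The gap between the two pieces of `A`. -/
theorem isGap_main (h : TwoPieceSystem a b c d A B) : IsGap A a (1 - b) := by
  refine ⟨by linarith [h.hab], h.left_end_mem, h.right_start_mem, fun x hx h1 h2 => ?_⟩
  rcases (h.mem_A _).1 hx with ⟨y, hy, e⟩ | ⟨y, hy, e⟩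
  · nlinarith [(h.sub_A hy).2, h.a_pos]
  · nlinarith [(h.sub_B hy).1, h.b_pos]

theorem isGap_pow_mul (h : TwoPieceSystem a b c d A B) (n : ℕ) {p q : ℝ} (hg : IsGap A p q) :
    IsGap A (a ^ n * p) (a ^ n * q) := by
  have han : 0 < a ^ n := pow_pos h.a_pos n
  have hp := h.sub_A hg.left_mem
  have hq := h.sub_A hg.right_mem
  refine ⟨mul_lt_mul_of_pos_left hg.lt han, (h.pow_mul_mem_iff n hp.1 hp.2).2 hg.left_mem,
    (h.pow_mul_mem_iff n hq.1 hq.2).2 hg.right_mem, fun x hx h1 h2 => ?_⟩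
  obtain ⟨y, rfl⟩ : ∃ y, x = a ^ n * y := ⟨x / a ^ n, by field_simp⟩
  have h1' := lt_of_mul_lt_mul_left h1 han.le
  have h2' := lt_of_mul_lt_mul_left h2 han.le
  exact hg.not_mem y ((h.pow_mul_mem_iff n (hp.1.trans h1'.le) (h2'.le.trans hq.2)).1 hx) h1' h2'

theorem isGap_right (h : TwoPieceSystem a b c d A B) {p q : ℝ} (hg : IsGap B p q) :
    IsGap A (1 - b + b * p) (1 - b + b * q) := by
  have hb := h.b_pos
  have hp := h.sub_B hg.left_mem
  have hq := h.sub_B hg.right_mem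
  refine ⟨by nlinarith [hg.lt], (h.add_mul_mem_iff hp.1).2 hg.left_mem,
    (h.add_mul_mem_iff hq.1).2 hg.right_mem, fun x hx h1 h2 => ?_⟩
  obtain ⟨y, rfl⟩ : ∃ y, x = 1 - b + b * y := ⟨(x - (1 - b)) / b, by field_simp; ring⟩
  have h1' : p < y := by nlinarith
  have h2' : y < q := by nlinarith
  exact hg.not_mem y ((h.add_mul_mem_iff (hp.1.trans h1'.le)).1 hx) h1' h2'

/-! ### The structure of gaps -/

theorem isGap_cases (h : TwoPieceSystem a b c d A B) {p q : ℝ} (hg : IsGap A p q) :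
    (p = a ∧ q = 1 - b) ∨ (∃ p' q', IsGap A p' q' ∧ p = a * p' ∧ q = a * q') ∨
      ∃ p' q', IsGap B p' q' ∧ p = 1 - b + b * p' ∧ q = 1 - b + b * q' := by
  have ha := h.a_pos
  have hb := h.b_pos
  have hab := h.hab
  have hlt := hg.lt
  rcases (h.mem_A _).1 hg.left_mem with ⟨p', hp', ep⟩ | ⟨p', hp', ep⟩ <;>
  rcases (h.mem_A _).1 hg.right_mem with ⟨q', hq', eq⟩ | ⟨q', hq', eq⟩
  · refine Or.inr (Or.inl ⟨p', q', ⟨by nlinarith, hp', hq', fun x hx h1 h2 => ?_⟩, ep, eq⟩)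
    exact hg.not_mem (a * x) ((h.mem_A _).2 (Or.inl ⟨x, hx, rfl⟩)) (by nlinarith) (by nlinarith)
  · have hp1 := (h.sub_A hp').2
    have hq0 := (h.sub_B hq').1
    refine Or.inl ⟨le_antisymm (by nlinarith) ?_, le_antisymm ?_ (by nlinarith)⟩
    · by_contra! hlt
      exact hg.not_mem a h.left_end_mem hlt (by nlinarith)
    · by_contra! hlt
      exact hg.not_mem (1 - b) h.right_start_mem (by nlinarith) hlt
  · have hp1 := (h.sub_B hp').1
    have hq0 := (h.sub_A hq').2
    nlinarith
  · refine Or.inr (Or.inr ⟨p', q', ⟨by nlinarith, hp', hq', fun x hx h1 h2 => ?_⟩, ep, eq⟩)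
    exact hg.not_mem (1 - b + b * x) ((h.mem_A _).2 (Or.inr ⟨x, hx, rfl⟩))
      (by nlinarith) (by nlinarith)

/-- Every gap is obtained from one of the two main gaps by finitely many of the defining maps, so
properties of gaps can be proved by induction along these maps. The induction is well founded
because the maps shrink gap lengths by a uniform factor. -/
theorem gap_induction (h : TwoPieceSystem a b c d A B) {P Q : ℝ → ℝ → Prop}
    (mainA : P a (1 - b)) (mainB : Q c (1 - d))
    (leftA : ∀ p q, IsGap A p q → P p q → P (a * p) (a * q))
    (rightA : ∀ p q, IsGap B p q → Q p q → P (1 - b + b * p) (1 - b + b * q))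
    (leftB : ∀ p q, IsGap B p q → Q p q → Q (c * p) (c * q))
    (rightB : ∀ p q, IsGap A p q → P p q → Q (1 - d + d * p) (1 - d + d * q)) :
    (∀ p q, IsGap A p q → P p q) ∧ ∀ p q, IsGap B p q → Q p q := by
  have ha := h.a_pos
  have hb := h.b_pos
  have hc := h.c_pos
  have hd := h.d_pos
  have hab := h.hab
  have hcd := h.hcd
  obtain ⟨k, hk1, hka, hkb, hkc, hkd⟩ : ∃ k < 1, a ≤ k ∧ b ≤ k ∧ c ≤ k ∧ d ≤ k :=
    ⟨max (max a b) (max c d),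
      max_lt (max_lt (by linarith) (by linarith)) (max_lt (by linarith) (by linarith)),
      by simp, by simp, by simp, by simp⟩
  have hk0 : 0 < k := ha.trans_le hka
  have key : ∀ n : ℕ, (∀ p q, IsGap A p q → k ^ n < q - p → P p q) ∧
      ∀ p q, IsGap B p q → k ^ n < q - p → Q p q := by
    intro n
    induction n with
    | zero =>
      refine ⟨fun p q hg hl => ?_, fun p q hg hl => ?_⟩
      · have := (h.sub_A hg.left_mem).1
        have := (h.sub_A hg.right_mem).2
        rw [pow_zero] at hl
        linarith
      · have := (h.sub_B hg.left_mem).1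
        have := (h.sub_B hg.right_mem).2
        rw [pow_zero] at hl
        linarith
    | succ n ih =>
      have step : ∀ r p q : ℝ, r ≤ k → p < q → k ^ (n + 1) < r * (q - p) → k ^ n < q - p := by
        intro r p q hr hpq hlt
        have : k * k ^ n < k * (q - p) := by
          rw [← pow_succ']
          exact hlt.trans_le (mul_le_mul_of_nonneg_right hr (sub_pos.2 hpq).le)
        exact lt_of_mul_lt_mul_left this hk0.le
      refine ⟨fun p q hg hl => ?_, fun p q hg hl => ?_⟩
      · rcases h.isGap_cases hg with ⟨rfl, rfl⟩ | ⟨p', q', hg', rfl, rfl⟩ | ⟨p', q', hg', rfl, rfl⟩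
        · exact mainA
        · exact leftA _ _ hg' (ih.1 _ _ hg' (step a _ _ hka hg'.lt (by linarith)))
        · exact rightA _ _ hg' (ih.2 _ _ hg' (step b _ _ hkb hg'.lt (by linarith)))
      · rcases h.swap.isGap_cases hg with
          ⟨rfl, rfl⟩ | ⟨p', q', hg', rfl, rfl⟩ | ⟨p', q', hg', rfl, rfl⟩
        · exact mainB
        · exact leftB _ _ hg' (ih.2 _ _ hg' (step c _ _ hkc hg'.lt (by linarith)))
        · exact rightB _ _ hg' (ih.1 _ _ hg' (step d _ _ hkd hg'.lt (by linarith)))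
  refine ⟨fun p q hg => ?_, fun p q hg => ?_⟩
  · obtain ⟨n, hn⟩ := exists_pow_lt_of_lt_one (sub_pos.2 hg.lt) hk1
    exact (key n).1 p q hg hn
  · obtain ⟨n, hn⟩ := exists_pow_lt_of_lt_one (sub_pos.2 hg.lt) hk1
    exact (key n).2 p q hg hn

end TwoPieceSystem

/-- `(p, q)` is the image, under a cylinder map `x ↦ ρ x + τ`, of the main gap `(a, 1 - b)` of `A`
or of the main gap `(c, 1 - d)` of `B`, where `A ∩ [τ, τ + ρ]` is the image of `A` or of `B`
respectively. Cylinders of `A` that start at `0` are copies of `A`, which is why `τ` is positive in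
the second case. -/
def IsCylinderGap (a b c d : ℝ) (A B : Set ℝ) (p q : ℝ) : Prop :=
  ∃ ρ τ : ℝ, 0 < ρ ∧ ρ ≤ 1 ∧ 0 ≤ τ ∧ τ + ρ ≤ 1 ∧
    ((p = ρ * a + τ ∧ q = ρ * (1 - b) + τ ∧ ∀ x, 0 ≤ x → x ≤ 1 → (ρ * x + τ ∈ A ↔ x ∈ A)) ∨
     (0 < τ ∧ p = ρ * c + τ ∧ q = ρ * (1 - d) + τ ∧
      ∀ x, 0 ≤ x → x ≤ 1 → (ρ * x + τ ∈ A ↔ x ∈ B)))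

namespace TwoPieceSystem

variable {a b c d : ℝ} {A B : Set ℝ}

theorem isCylinderGap_left (h : TwoPieceSystem a b c d A B) {p q : ℝ}
    (hg : IsCylinderGap a b c d A B p q) : IsCylinderGap a b c d A B (a * p) (a * q) := by
  have ha := h.a_pos
  have ha1 : a ≤ 1 := by linarith [h.b_pos, h.hab]
  obtain ⟨ρ, τ, hρ, hρ1, hτ, hτ1, H⟩ := hg
  have hmem : ∀ x, 0 ≤ x → x ≤ 1 → (a * ρ * x + a * τ ∈ A ↔ ρ * x + τ ∈ A) := by
    intro x hx0 hx1
    rw [show a * ρ * x + a * τ = a * (ρ * x + τ) by ring]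
    exact h.mul_mem_iff (by nlinarith)
  refine ⟨a * ρ, a * τ, by positivity, by nlinarith, by positivity, by nlinarith, ?_⟩
  rcases H with ⟨rfl, rfl, H⟩ | ⟨h0, rfl, rfl, H⟩
  · exact Or.inl ⟨by ring, by ring, fun x hx0 hx1 => (hmem x hx0 hx1).trans (H x hx0 hx1)⟩
  · exact Or.inr ⟨by positivity, by ring, by ring,
      fun x hx0 hx1 => (hmem x hx0 hx1).trans (H x hx0 hx1)⟩

theorem isCylinderGap_right (h : TwoPieceSystem a b c d A B) {p q : ℝ}
    (hg : IsCylinderGap c d a b B A p q) :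
    IsCylinderGap a b c d A B (1 - b + b * p) (1 - b + b * q) := by
  have hb := h.b_pos
  have hb1 : b < 1 := by linarith [h.a_pos, h.hab]
  obtain ⟨ρ, τ, hρ, hρ1, hτ, hτ1, H⟩ := hg
  have hmem : ∀ x, 0 ≤ x → (b * ρ * x + (1 - b + b * τ) ∈ A ↔ ρ * x + τ ∈ B) := by
    intro x hx0
    rw [show b * ρ * x + (1 - b + b * τ) = 1 - b + b * (ρ * x + τ) by ring]
    exact h.add_mul_mem_iff (by positivity)
  have hbτ : 0 ≤ b * τ := by positivity
  refine ⟨b * ρ, 1 - b + b * τ, by positivity, by nlinarith, by linarith, by nlinarith, ?_⟩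
  rcases H with ⟨rfl, rfl, H⟩ | ⟨h0, rfl, rfl, H⟩
  · exact Or.inr ⟨by linarith, by ring, by ring,
      fun x hx0 hx1 => (hmem x hx0).trans (H x hx0 hx1)⟩
  · exact Or.inl ⟨by ring, by ring, fun x hx0 hx1 => (hmem x hx0).trans (H x hx0 hx1)⟩

theorem isCylinderGap_main (a b c d : ℝ) (A B : Set ℝ) : IsCylinderGap a b c d A B a (1 - b) :=
  ⟨1, 0, one_pos, le_rfl, le_rfl, by norm_num, Or.inl ⟨by ring, by ring, by simp⟩⟩

theorem isCylinderGap (h : TwoPieceSystem a b c d A B) {p q : ℝ} (hg : IsGap A p q) :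
    IsCylinderGap a b c d A B p q :=
  (h.gap_induction (P := IsCylinderGap a b c d A B) (Q := IsCylinderGap c d a b B A)
    (isCylinderGap_main ..) (isCylinderGap_main ..)
    (fun _ _ _ => h.isCylinderGap_left) (fun _ _ _ => h.isCylinderGap_right)
    (fun _ _ _ => h.swap.isCylinderGap_left) (fun _ _ _ => h.swap.isCylinderGap_right)).1 p q hg

/-! ### Gaps seen from the left endpoint -/

/-- If `m` is at most the endpoint ratios `p / q` of both main gaps `(p, q)`, it is at most those of
all gaps. -/
theorem mul_le_of_isGap (h : TwoPieceSystem a b c d A B) {m : ℝ} (hA : m * (1 - b) ≤ a)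
    (hB : m * (1 - d) ≤ c) {p q : ℝ} (hg : IsGap A p q) : m * q ≤ p := by
  have ha := h.a_pos
  have hb := h.b_pos
  have hc := h.c_pos
  have hd := h.d_pos
  have hab := h.hab
  have hcd := h.hcd
  refine (h.gap_induction (P := fun p q => m * q ≤ p) (Q := fun p q => m * q ≤ p) hA hB
    ?_ ?_ ?_ ?_).1 p q hg
  all_goals
    intro p q _ hpq
    nlinarith

theorem mul_lt_add_mul (h : TwoPieceSystem a b c d A B) {m p q : ℝ} (hm : m < 1)
    (hpq : m * q ≤ p) : m * (1 - b + b * q) < 1 - b + b * p := by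
  have h1 : 0 < (1 - m) * (1 - b) :=
    mul_pos (by linarith) (by linarith [h.a_pos, h.hab])
  nlinarith [h.b_pos]

/-- If `m` is at most the endpoint ratios of both main gaps, the only gaps of `A` with ratio at most
`m` can be the scaled copies `aᵏ (a, 1 - b)` of `A`'s main gap: shifting a gap to the right strictly
raises its ratio. -/
theorem eq_pow_of_isGap (h : TwoPieceSystem a b c d A B) {m : ℝ} (hm : m < 1)
    (hA : m * (1 - b) ≤ a) (hB : m * (1 - d) ≤ c) {p q : ℝ} (hg : IsGap A p q)
    (hpq : p ≤ m * q) : ∃ k : ℕ, p = a ^ (k + 1) := by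
  have ha := h.a_pos
  refine (h.gap_induction (P := fun p q => p ≤ m * q → ∃ k : ℕ, p = a ^ (k + 1))
    (Q := fun _ _ => True) (fun _ => ⟨0, by simp⟩) trivial ?_ ?_
    (fun _ _ _ _ => trivial) (fun _ _ _ _ => trivial)).1 p q hg hpq
  · intro p q _ ih hpq
    obtain ⟨k, rfl⟩ := ih (by nlinarith)
    exact ⟨k + 1, by ring⟩
  · intro p q hg _ hpq
    exact absurd (h.mul_lt_add_mul hm (h.swap.mul_le_of_isGap hB hA hg)) (not_lt.2 hpq)

/-- If `A`'s main gap has a smaller endpoint ratio `m` than that of `B`, then all gaps of `B` have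
ratio greater than `m`. -/
theorem mul_lt_of_isGap (h : TwoPieceSystem a b c d A B) {m : ℝ} (hm : m < 1)
    (hA : m * (1 - b) ≤ a) (hB : m * (1 - d) < c) {p q : ℝ} (hg : IsGap B p q) : m * q < p := by
  have hc := h.c_pos
  refine (h.gap_induction (P := fun p q => m * q ≤ p) (Q := fun p q => m * q < p) hA hB
    ?_ ?_ ?_ ?_).2 p q hg
  · intro p q _ hpq
    nlinarith [h.a_pos]
  · intro p q _ hpq
    exact (h.mul_lt_add_mul hm hpq.le).le
  · intro p q _ hpq
    nlinarith
  · intro p q _ hpq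
    exact h.swap.mul_lt_add_mul hm hpq

/-- If `A`'s main gap has a smaller endpoint ratio than that of `B`, then `A` contains no scaled
copy of `B` with the same left endpoint. -/
theorem not_mul_mem (h : TwoPieceSystem a b c d A B) (hlt : a * (1 - d) < c * (1 - b)) {l : ℝ}
    (hl : 0 < l) (hsub : ∀ y ∈ B, l * y ∈ A) : False := by
  have ha := h.a_pos
  have hb := h.b_pos
  have hab := h.hab
  have hb1 : 0 < 1 - b := by linarith
  have hm : a / (1 - b) < 1 := by rw [div_lt_one hb1]; linarith
  obtain ⟨n, hn⟩ := exists_pow_lt_of_lt_one hl (show a < 1 by linarith)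
  have han : 0 < a ^ n := pow_pos ha n
  have hgap := h.isGap_pow_mul n h.isGap_main
  obtain ⟨p, q, hg, hp, hq⟩ := exists_isGap_of_disjoint h.closed_B
    (s := a ^ n * a / l) (t := a ^ n * (1 - b) / l) (div_lt_div_of_pos_right hgap.lt hl)
    h.zero_B (by positivity) h.one_B (by rw [div_le_one hl]; nlinarith) (fun z hz h1 h2 =>
      hgap.not_mem (l * z) (hsub z hz) (by rw [div_lt_iff₀' hl] at h1; exact h1)
        (by rw [lt_div_iff₀' hl] at h2; exact h2))
  have h1 := h.mul_lt_of_isGap hm (by rw [div_mul_cancel₀ _ hb1.ne'])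
    (by rw [div_mul_eq_mul_div, div_lt_iff₀ hb1]; exact hlt) hg
  rw [le_div_iff₀ hl] at hp
  rw [div_le_iff₀ hl] at hq
  rw [div_mul_eq_mul_div, div_lt_iff₀ hb1] at h1
  nlinarith

/-! ### Gaps seen from the right endpoint -/

theorem one_sub_le_of_isGap (h : TwoPieceSystem a b c d A B) {m : ℝ}
    (hA : m * (1 - a) ≤ b) (hB : m * (1 - c) ≤ d) {p q : ℝ} (hg : IsGap A p q) :
    m * (1 - p) ≤ 1 - q := by
  have ha := h.a_pos
  have hb := h.b_pos
  have hc := h.c_pos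
  have hd := h.d_pos
  have hab := h.hab
  have hcd := h.hcd
  refine (h.gap_induction (P := fun p q => m * (1 - p) ≤ 1 - q)
    (Q := fun p q => m * (1 - p) ≤ 1 - q) (by linarith) (by linarith) ?_ ?_ ?_ ?_).1 p q hg
  all_goals
    intro p q _ hpq
    nlinarith

/-- Gaps of `A` with the smallest endpoint ratio as seen from `1` are the main gaps of the cylinders
that contain `1`. -/
theorem eq_of_isGap_of_one_sub_le (h : TwoPieceSystem a b c d A B) {m : ℝ} (hm : m < 1)
    (hA : m * (1 - a) ≤ b) (hB : m * (1 - c) ≤ d) {p q : ℝ} (hg : IsGap A p q)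
    (hpq : 1 - q ≤ m * (1 - p)) :
    (∃ k : ℕ, 1 - q = (b * d) ^ k * b ∧ 1 - p = (b * d) ^ k * (1 - a)) ∨
      ∃ k : ℕ, 1 - q = (b * d) ^ k * b * d ∧ 1 - p = (b * d) ^ k * b * (1 - c) := by
  have ha := h.a_pos
  have hb := h.b_pos
  have hc := h.c_pos
  have hd := h.d_pos
  have hab := h.hab
  have hcd := h.hcd
  refine (h.gap_induction
    (P := fun p q => 1 - q ≤ m * (1 - p) →
      (∃ k : ℕ, 1 - q = (b * d) ^ k * b ∧ 1 - p = (b * d) ^ k * (1 - a)) ∨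
      ∃ k : ℕ, 1 - q = (b * d) ^ k * b * d ∧ 1 - p = (b * d) ^ k * b * (1 - c))
    (Q := fun p q => 1 - q ≤ m * (1 - p) →
      (∃ k : ℕ, 1 - q = (b * d) ^ k * d ∧ 1 - p = (b * d) ^ k * (1 - c)) ∨
      ∃ k : ℕ, 1 - q = (b * d) ^ k * d * b ∧ 1 - p = (b * d) ^ k * d * (1 - a))
    (fun _ => Or.inl ⟨0, by simp⟩) (fun _ => Or.inl ⟨0, by simp⟩) ?_ ?_ ?_ ?_).1 p q hg hpq
  · intro p q hg _ hpq
    have := h.one_sub_le_of_isGap hA hB hg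
    nlinarith
  · intro p q _ ih hpq
    rcases ih (by nlinarith) with ⟨k, e1, e2⟩ | ⟨k, e1, e2⟩
    · exact Or.inr ⟨k, by linear_combination b * e1, by linear_combination b * e2⟩
    · exact Or.inl ⟨k + 1, by linear_combination b * e1, by linear_combination b * e2⟩
  · intro p q hg _ hpq
    have := h.swap.one_sub_le_of_isGap hB hA hg
    nlinarith
  · intro p q _ ih hpq
    rcases ih (by nlinarith) with ⟨k, e1, e2⟩ | ⟨k, e1, e2⟩
    · exact Or.inr ⟨k, by linear_combination d * e1, by linear_combination d * e2⟩
    · exact Or.inl ⟨k + 1, by linear_combination d * e1, by linear_combination d * e2⟩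

/-- If `A ⊆ B`, a gap of `B` whose endpoint ratio as seen from `1` is the smallest possible one is
also a gap of `A`. -/
theorem isGap_of_subset (h : TwoPieceSystem a b c d A B) (hsub : A ⊆ B) {m : ℝ} (hm0 : 0 < m)
    (hA : m * (1 - a) ≤ b) (hB : m * (1 - c) ≤ d) {p q : ℝ} (hg : IsGap B p q)
    (hpq : 1 - q = m * (1 - p)) : IsGap A p q := by
  obtain ⟨p', q', hg', hp, hq⟩ := exists_isGap_of_disjoint h.closed_A hg.lt h.zero_A
    (h.sub_B hg.left_mem).1 h.one_A (h.sub_B hg.right_mem).2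
    (fun z hz h1 h2 => hg.not_mem z (hsub hz) h1 h2)
  have h1 := h.one_sub_le_of_isGap hA hB hg'
  have e1 : q' = q := by nlinarith
  have e2 : p' = p := by nlinarith
  rwa [e1, e2] at hg'

/-- `A` is contained in `B` only if both sets have the same parameters: otherwise a gap of `B` of
smallest endpoint ratio as seen from `1`, of the form `(c, 1 - d)` or its analogue one level down,
would have to occur among the gaps of `A`, whose positions do not fit. -/
theorem eq_of_subset (h : TwoPieceSystem a b c d A B) (hsub : A ⊆ B) : a = c ∧ b = d := by
  have ha := h.a_pos
  have hb := h.b_pos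
  have hc := h.c_pos
  have hd := h.d_pos
  have hab := h.hab
  have hcd := h.hcd
  have hbd : 0 < b * d := by positivity
  have ha1 : 0 < 1 - a := by linarith
  have hc1 : 0 < 1 - c := by linarith
  have hpow : ∀ k : ℕ, (b * d) ^ k ≤ 1 := fun k => pow_le_one₀ hbd.le (by nlinarith)
  rcases le_or_gt (d * (1 - a)) (b * (1 - c)) with hle | hlt
  · have hm : d / (1 - c) < 1 := by rw [div_lt_one hc1]; linarith
    have hA : d / (1 - c) * (1 - a) ≤ b := by
      rw [div_mul_eq_mul_div, div_le_iff₀ hc1]; exact hle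
    have hB : d / (1 - c) * (1 - c) = d := div_mul_cancel₀ _ hc1.ne'
    have hg := h.isGap_of_subset hsub (by positivity) hA hB.le h.swap.isGap_main
      (by rw [hB]; ring)
    rcases h.eq_of_isGap_of_one_sub_le hm hA hB.le hg (by rw [hB]; linarith) with
      ⟨k, e1, e2⟩ | ⟨k, e1, e2⟩
    · rcases k with _ | k
      · simp only [pow_zero, one_mul] at e1 e2
        exact ⟨by linarith, by linarith⟩
      · rw [pow_succ] at e1
        have hk := mul_le_mul_of_nonneg_right (hpow k) (show 0 ≤ b * d * b by positivity)
        have : b * b < 1 := by nlinarith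
        nlinarith
    · have hk := mul_le_mul_of_nonneg_right (hpow k) (show 0 ≤ b * d by positivity)
      nlinarith
  · have hm : b / (1 - a) < 1 := by rw [div_lt_one ha1]; linarith
    have hB : b / (1 - a) * (1 - c) < d := by
      rw [div_mul_eq_mul_div, div_lt_iff₀ ha1]; exact hlt
    have hA : b / (1 - a) * (1 - a) = b := div_mul_cancel₀ _ ha1.ne'
    have hg := h.isGap_of_subset hsub (by positivity) hA.le hB.le
      (h.swap.isGap_right h.isGap_main) (by linear_combination -d * hA)
    rcases h.eq_of_isGap_of_one_sub_le hm hA.le hB.le hg (by linear_combination -d * hA) with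
      ⟨k, e1, e2⟩ | ⟨k, e1, e2⟩
    · rcases k with _ | k
      · simp only [pow_zero, one_mul] at e1
        nlinarith
      · rw [pow_succ] at e1
        have hk := mul_le_mul_of_nonneg_right (hpow k) (show 0 ≤ b * d * b by positivity)
        have : 0 < d * b * (1 - b) := mul_pos (by positivity) (by linarith)
        nlinarith
    · rcases k with _ | k
      · simp only [pow_zero, one_mul] at e2
        nlinarith
      · rw [pow_succ] at e1
        have hk := mul_le_mul_of_nonneg_right (hpow k) (show 0 ≤ b * d * b * d by positivity)
        have : 0 < d * b * (1 - b * d) := mul_pos (by positivity) (by nlinarith)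
        nlinarith

/-- With equal parameters the system is a standard one, and its attractor is unique. -/
theorem subset_of_eq (h : TwoPieceSystem a b a b A B) : A ⊆ B := by
  have ha := h.a_pos
  have hb := h.b_pos
  have hab := h.hab
  have step : ∀ {x y r s : ℝ} (t : ℝ), 0 < r → r ≤ a + b → |x - y| ≤ s →
      |(t + r * x) - (t + r * y)| ≤ (a + b) * s := by
    intro x y r s t hr hrab hxy
    rw [add_sub_add_left_eq_sub, ← mul_sub, abs_mul, abs_of_pos hr]
    exact mul_le_mul hrab hxy (abs_nonneg _) (by linarith)
  have key : ∀ n : ℕ, (∀ x ∈ A, ∃ y ∈ B, |x - y| ≤ (a + b) ^ n) ∧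
      ∀ x ∈ B, ∃ y ∈ A, |x - y| ≤ (a + b) ^ n := by
    intro n
    induction n with
    | zero =>
      refine ⟨fun x hx => ⟨0, h.zero_B, ?_⟩, fun x hx => ⟨0, h.zero_A, ?_⟩⟩
      · have := h.sub_A hx
        rw [sub_zero, pow_zero, abs_of_nonneg this.1]
        exact this.2
      · have := h.sub_B hx
        rw [sub_zero, pow_zero, abs_of_nonneg this.1]
        exact this.2
    | succ n ih =>
      rw [pow_succ']
      refine ⟨fun x hx => ?_, fun x hx => ?_⟩
      · rcases (h.mem_A x).1 hx with ⟨x', hx', rfl⟩ | ⟨x', hx', rfl⟩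
        · obtain ⟨y, hy, hxy⟩ := ih.1 x' hx'
          refine ⟨a * y, (h.mem_B _).2 (Or.inl ⟨y, hy, rfl⟩), ?_⟩
          simpa only [zero_add] using step 0 ha (by linarith) hxy
        · obtain ⟨y, hy, hxy⟩ := ih.2 x' hx'
          exact ⟨_, (h.mem_B _).2 (Or.inr ⟨y, hy, rfl⟩), step _ hb (by linarith) hxy⟩
      · rcases (h.mem_B x).1 hx with ⟨x', hx', rfl⟩ | ⟨x', hx', rfl⟩
        · obtain ⟨y, hy, hxy⟩ := ih.2 x' hx'
          refine ⟨a * y, (h.mem_A _).2 (Or.inl ⟨y, hy, rfl⟩), ?_⟩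
          simpa only [zero_add] using step 0 ha (by linarith) hxy
        · obtain ⟨y, hy, hxy⟩ := ih.1 x' hx'
          exact ⟨_, (h.mem_A _).2 (Or.inr ⟨y, hy, rfl⟩), step _ hb (by linarith) hxy⟩
  intro x hx
  rw [← h.closed_B.closure_eq, Metric.mem_closure_iff]
  intro ε hε
  obtain ⟨n, hn⟩ := exists_pow_lt_of_lt_one hε hab
  obtain ⟨y, hy, hxy⟩ := (key n).1 x hx
  exact ⟨y, hy, by rw [Real.dist_eq]; linarith⟩

theorem eq_of_subset_left (h : TwoPieceSystem a b c d A B) (hsub : A ⊆ B) : A = B := by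
  obtain ⟨rfl, rfl⟩ := h.eq_of_subset hsub
  exact hsub.antisymm h.swap.subset_of_eq

/-! ### Copies of one set inside the other -/

/-- A contracted copy `r A + t ⊆ A` looks, to the right of the point `1 - b` where the right-hand
piece of `A` begins, like a scaled copy of `A` near `0`, or is empty there. The alternative that it
looks like `B` near `0` would make its gap ending at `1 - b` shorter than the main gap of `A`. -/
theorem local_copy (h : TwoPieceSystem a b c d A B) {r t : ℝ} (hr0 : 0 < r) (hr1 : r < 1)
    (hT : ∀ x ∈ A, r * x + t ∈ A) :
    ∃ ε > 0, ∃ ρ : ℝ, ∀ z ∈ B, z < ε → (∃ x ∈ A, 1 - b + b * z = r * x + t) →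
      0 < ρ ∧ (∀ x ∈ A, ρ * x ∈ B) ∧ ∃ y ∈ A, z = ρ * y := by
  have ha := h.a_pos
  have hb := h.b_pos
  have hab := h.hab
  by_cases hmem : ∃ x ∈ A, 1 - b = r * x + t
  · obtain ⟨x₀, hx₀, e₀⟩ := hmem
    obtain ⟨k, hk0, hcopy, hlocal⟩ : ∃ k > 0, (∀ y ∈ A, x₀ + k * y ∈ A) ∧
        ∀ w ∈ A, x₀ ≤ w → w ≤ x₀ + k → ∃ y ∈ A, w = x₀ + k * y := by
      rcases (h.sub_A hx₀).1.eq_or_lt with rfl | hpos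
      · exact ⟨1, one_pos, fun y hy => by simpa using hy, fun w hw _ _ => ⟨w, hw, by ring⟩⟩
      · obtain ⟨p, q, hg, hp, hq⟩ := exists_isGap_of_disjoint h.closed_A
          (s := (a - t) / r) (t := x₀) (by rw [div_lt_iff₀ hr0]; nlinarith) h.zero_A
          (by
            by_contra! hlt
            rw [div_lt_iff₀ hr0] at hlt
            exact h.isGap_main.not_mem _ (hT 0 h.zero_A) (by linarith) (by nlinarith))
          hx₀ le_rfl (fun z hz h1 h2 => by
            rw [div_lt_iff₀ hr0] at h1
            exact h.isGap_main.not_mem _ (hT z hz) (by linarith) (by nlinarith))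
        have hqx : q = x₀ := by
          by_contra hne
          have hlt : x₀ < q := lt_of_le_of_ne hq (Ne.symm hne)
          refine hg.not_mem x₀ hx₀ (hp.trans_lt ?_) hlt
          rw [div_lt_iff₀ hr0]
          nlinarith
        subst hqx
        obtain ⟨ρ, τ, hρ, hρ1, hτ, hτ1, ⟨ep, eq, _⟩ | ⟨_, _, eq, H⟩⟩ := h.isCylinderGap hg
        · rw [le_div_iff₀ hr0] at hp
          have h1 : 1 - b - a ≤ r * ρ * (1 - b - a) := by
            subst ep
            linear_combination hp + e₀ + r * eq
          have h2 : r * ρ < 1 := by nlinarith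
          nlinarith
        · have hd := h.d_pos
          have hd1 : d ≤ 1 := by linarith [h.c_pos, h.hcd]
          have hiff : ∀ y, 0 ≤ y → y ≤ 1 → (q + ρ * d * y ∈ A ↔ y ∈ A) := by
            intro y hy0 hy1
            rw [show q + ρ * d * y = ρ * (1 - d + d * y) + τ by rw [eq]; ring]
            exact (H _ (by nlinarith) (by nlinarith)).trans (h.swap.add_mul_mem_iff hy0)
          have hρd : 0 < ρ * d := by positivity
          refine ⟨ρ * d, hρd, fun y hy => (hiff y (h.sub_A hy).1 (h.sub_A hy).2).2 hy,
            fun w hw h1 h2 => ?_⟩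
          obtain ⟨y, rfl⟩ : ∃ y, w = q + ρ * d * y := ⟨(w - q) / (ρ * d), by field_simp; ring⟩
          exact ⟨y, (hiff y (by nlinarith) (by nlinarith)).1 hw, rfl⟩
    -- Shrinking by a power of `a` makes the copy fit into the right-hand piece of `A`.
    have hrk : 0 < r * k := by positivity
    obtain ⟨n, hn⟩ := exists_pow_lt_of_lt_one (show 0 < b / (r * k) by positivity)
      (show a < 1 by linarith)
    have han : 0 < a ^ n := pow_pos ha n
    have han1 : a ^ n ≤ 1 := pow_le_one₀ ha.le (by linarith)
    rw [lt_div_iff₀ hrk] at hn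
    have hρ0 : 0 < r * k * a ^ n / b := by positivity
    have hbρ : b * (r * k * a ^ n / b) = r * k * a ^ n := by field_simp
    refine ⟨_, hρ0, r * k * a ^ n / b, fun z hz hzε ⟨x, hx, ex⟩ => ⟨hρ0, fun y hy => ?_, ?_⟩⟩
    · have hy' := h.sub_A hy
      refine (h.add_mul_mem_iff (mul_nonneg hρ0.le hy'.1)).1 ?_
      have := hT _ (hcopy _ ((h.pow_mul_mem_iff n hy'.1 hy'.2).2 hy))
      convert this using 1
      linear_combination e₀ + y * hbρ
    · have hz0 := (h.sub_B hz).1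
      have hbz : b * z < r * k * a ^ n := by rw [← hbρ]; exact mul_lt_mul_of_pos_left hzε hb
      have hrx : r * (x - x₀) = b * z := by linear_combination e₀ - ex
      have hx1 : x₀ ≤ x := by
        have : 0 ≤ r * (x - x₀) := by rw [hrx]; positivity
        linarith [nonneg_of_mul_nonneg_right this hr0]
      have hx2 : x - x₀ < k * a ^ n := by nlinarith
      obtain ⟨w, hw, ew⟩ := hlocal x hx hx1 (by nlinarith)
      have hw' := h.sub_A hw
      obtain ⟨y, rfl⟩ : ∃ y, w = a ^ n * y := ⟨w / a ^ n, by field_simp⟩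
      have hy0 : 0 ≤ y := nonneg_of_mul_nonneg_right hw'.1 han
      have hy1 : y ≤ 1 := by
        have : k * a ^ n * y < k * a ^ n * 1 := by linarith
        exact (lt_of_mul_lt_mul_left this (by positivity)).le
      refine ⟨y, (h.pow_mul_mem_iff n hy0 hy1).1 hw, ?_⟩
      rw [div_mul_eq_mul_div, eq_div_iff hb.ne']
      rw [ew] at hrx
      linear_combination -hrx
  · -- The copy is closed, so it stays away from `1 - b` if it does not contain that point.
    have hcl : IsClosed {z : ℝ | (1 - b + b * z - t) / r ∈ A} :=
      h.closed_A.preimage (by fun_prop)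
    have h0 : (0 : ℝ) ∉ {z : ℝ | (1 - b + b * z - t) / r ∈ A} :=
      fun h0 => hmem ⟨_, h0, by field_simp; ring⟩
    obtain ⟨ε, hε, hball⟩ := Metric.isOpen_iff.1 hcl.isOpen_compl 0 h0
    refine ⟨ε, hε, 0, fun z hz hzε ⟨x, hx, ex⟩ => absurd ?_ (hball (?_ : z ∈ Metric.ball 0 ε))⟩
    · rw [mem_ofPred_eq, show (1 - b + b * z - t) / r = x by
        rw [div_eq_iff hr0.ne']; linarith]
      exact hx
    · rw [Metric.mem_ball, Real.dist_eq, sub_zero, abs_of_nonneg (h.sub_B hz).1]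
      exact hzε

/-- `B` is not covered near `0` by finitely many scaled copies of `A` that lie in `B`. The argument
compares the gaps of these copies with the gaps `cⁿ (c, 1 - d)` of `B`, at the left or the right end
of these gaps according to which of the two main gaps has the smaller endpoint ratio. -/
theorem not_locally_covered (h : TwoPieceSystem a b c d A B) (hne : A ≠ B) {ι : Type*} [Finite ι]
    {ε : ℝ} (hε : 0 < ε) (ρ : ι → ℝ)
    (hcov : ∀ z ∈ B, z < ε → ∃ i, 0 < ρ i ∧ (∀ x ∈ A, ρ i * x ∈ B) ∧ ∃ y ∈ A, z = ρ i * y) :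
    False := by
  have ha := h.a_pos
  have hb := h.b_pos
  have hc := h.c_pos
  have hd := h.d_pos
  have hab := h.hab
  have hcd := h.hcd
  have hlim := tendsto_pow_atTop_nhds_zero_of_lt_one hc.le (show c < 1 by linarith)
  obtain ⟨n, hnε, hnρ⟩ : ∃ n : ℕ, c ^ n < ε ∧ ∀ i, 0 < ρ i → c ^ n < ρ i := by
    refine ((hlim.eventually_lt_const hε).and (eventually_all.2 fun i => ?_)).exists
    by_cases hi : 0 < ρ i
    · filter_upwards [hlim.eventually_lt_const hi] with n hn _ using hn
    · exact Eventually.of_forall fun n hi' => absurd hi' hi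
  have hcn : 0 < c ^ n := pow_pos hc n
  have hgap := h.swap.isGap_pow_mul n h.swap.isGap_main
  have hsmall : ∀ z, z < c ^ n * 1 → z < ε := fun z hz => by linarith
  -- The gap of `ρ A` around the gap `cⁿ (c, 1 - d)` of `B`.
  have hcover : ∀ i, 0 < ρ i → (∀ x ∈ A, ρ i * x ∈ B) →
      ∃ p q, IsGap A p q ∧ ρ i * p ≤ c ^ n * c ∧ c ^ n * (1 - d) ≤ ρ i * q := by
    intro i hi hsub
    obtain ⟨p, q, hg, hp, hq⟩ := exists_isGap_of_disjoint h.closed_A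
      (s := c ^ n * c / ρ i) (t := c ^ n * (1 - d) / ρ i) (div_lt_div_of_pos_right hgap.lt hi)
      h.zero_A (by positivity) h.one_A (by rw [div_le_one hi]; nlinarith [hnρ i hi])
      (fun z hz h1 h2 => hgap.not_mem _ (hsub z hz) ((div_lt_iff₀' hi).1 h1)
        ((lt_div_iff₀' hi).1 h2))
    exact ⟨p, q, hg, (le_div_iff₀' hi).1 hp, (div_le_iff₀' hi).1 hq⟩
  rcases le_or_gt (c * (1 - b)) (a * (1 - d)) with hle | hlt
  · -- The copy through `cⁿ⁺¹` must have a gap `aᵏ (a, 1 - b)` there, so `cⁿ⁺¹ A ⊆ B`, hence `A ⊆ B`.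
    obtain ⟨i, hi, hsub, y, hy, ey⟩ := hcov _ hgap.left_mem (hsmall _ (by nlinarith))
    obtain ⟨p, q, hg, hp, hq⟩ := hcover i hi hsub
    have hpy : p = y := by
      rw [ey] at hp
      refine le_antisymm (le_of_mul_le_mul_left hp hi) ?_
      by_contra! hlt
      refine hg.not_mem y hy hlt (lt_of_mul_lt_mul_left ?_ hi.le)
      rw [← ey]
      exact hgap.lt.trans_le hq
    subst hpy
    have hd1 : 0 < 1 - d := by linarith
    have hm : c / (1 - d) < 1 := by rw [div_lt_one hd1]; linarith
    obtain ⟨k, rfl⟩ := h.eq_pow_of_isGap hm (by rw [div_mul_eq_mul_div, div_le_iff₀ hd1]; exact hle)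
      (div_mul_cancel₀ _ hd1.ne').le hg (by
        rw [div_mul_eq_mul_div, le_div_iff₀ hd1]
        refine le_of_mul_le_mul_left ?_ hi
        nlinarith)
    refine hne (h.eq_of_subset_left fun x hx => ?_)
    have hx' := h.sub_A hx
    refine (h.swap.pow_mul_mem_iff (n + 1) hx'.1 hx'.2).1 ?_
    rw [pow_succ, ey, mul_assoc]
    exact hsub _ ((h.pow_mul_mem_iff (k + 1) hx'.1 hx'.2).2 hx)
  · -- Here the copy through the right end `cⁿ (1 - d)` is considered.
    obtain ⟨i, hi, hsub, y, hy, ey⟩ := hcov _ hgap.right_mem (hsmall _ (by nlinarith))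
    obtain ⟨p, q, hg, hp, hq⟩ := hcover i hi hsub
    have hqy : q = y := by
      rw [ey] at hq
      refine le_antisymm ?_ (le_of_mul_le_mul_left hq hi)
      by_contra! hlt
      refine hg.not_mem y hy (lt_of_mul_lt_mul_left ?_ hi.le) hlt
      rw [← ey]
      exact hp.trans_lt hgap.lt
    subst hqy
    obtain ⟨μ, τ, hμ, hμ1, hτ, hτ1, ⟨_, eq, H⟩ | ⟨hτ0, ep, eq, _⟩⟩ := h.isCylinderGap hg
    · -- `B` near `0` embeds into `B` near `1 - d`, that is, into `A` near `0`.
      obtain ⟨k, hk⟩ := exists_pow_lt_of_lt_one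
        (show 0 < c ^ n * d / (ρ i * μ * b) by positivity) (show c < 1 by linarith)
      have hck : 0 < c ^ k := pow_pos hc k
      rw [lt_div_iff₀ (by positivity)] at hk
      refine h.not_mul_mem hlt (l := ρ i * μ * b * c ^ k / (c ^ n * d)) (by positivity)
        fun y hy => ?_
      have hy' := h.sub_B hy
      have hl : c ^ n * d * (ρ i * μ * b * c ^ k / (c ^ n * d)) = ρ i * μ * b * c ^ k := by
        field_simp
      set l := ρ i * μ * b * c ^ k / (c ^ n * d) with hldef
      have hl0 : 0 < l := by positivity
      have hl1 : l ≤ 1 := by rw [hldef, div_le_one (by positivity)]; linarith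
      have hly0 : 0 ≤ l * y := mul_nonneg hl0.le hy'.1
      have hly1 : l * y ≤ 1 := mul_le_one₀ hl1 hy'.1 hy'.2
      refine (h.swap.add_mul_mem_iff hly0).1
        ((h.swap.pow_mul_mem_iff n (by nlinarith) (by nlinarith)).1 ?_)
      have hck1 : c ^ k ≤ 1 := pow_le_one₀ hc.le (by linarith)
      have hcy0 : 0 ≤ c ^ k * y := mul_nonneg hck.le hy'.1
      have hcy1 : c ^ k * y ≤ 1 := mul_le_one₀ hck1 hy'.1 hy'.2
      have hmem : 1 - b + b * (c ^ k * y) ∈ A :=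
        (h.add_mul_mem_iff hcy0).2 ((h.swap.pow_mul_mem_iff k hy'.1 hy'.2).2 hy)
      have := hsub _ ((H _ (by nlinarith) (by nlinarith)).2 hmem)
      convert this using 1
      rw [eq] at ey
      linear_combination ey + y * hl
    · -- The gap is the main gap of a copy of `B` at least as long as `cⁿ B`, with the same right
      -- end, so this copy of `B` starts at or below `0`, contrary to `0 < τ`.
      have h1 : c ^ n * (1 - c - d) ≤ ρ i * μ * (1 - c - d) := by
        rw [eq] at ey
        rw [ep] at hp
        linarith
      have h2 : c ^ n ≤ ρ i * μ := le_of_mul_le_mul_right h1 (by linarith)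
      have h3 : 0 < ρ i * τ := by positivity
      rw [eq] at ey
      nlinarith

theorem not_isStandardIFSAttractor (h : TwoPieceSystem a b c d A B) (hne : A ≠ B) :
    ¬ IsStandardIFSAttractor A := by
  rintro ⟨n, Φ, hmono, -, hattr⟩
  have hb := h.b_pos
  have hmap : ∀ i x, Φ.map i x = Φ.ratio i * x + Φ.map i 0 := by
    intro i x
    have hs := Φ.similarity i x 0
    rw [sub_zero] at hs
    rcases le_total 0 x with hx | hx
    · rw [abs_of_nonneg hx, abs_of_nonneg (sub_nonneg.2 ((hmono i).monotone hx))] at hs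
      linarith
    · rw [abs_of_nonpos hx, abs_of_nonpos (sub_nonpos.2 ((hmono i).monotone hx))] at hs
      linarith
  have hA : ∀ x, x ∈ A ↔ ∃ i, ∃ y ∈ A, Φ.ratio i * y + Φ.map i 0 = x := by
    intro x
    have hAu : A = ⋃ e ∈ {e | Φ.init e = ()}, Φ.map e '' A := hattr ()
    conv_lhs => rw [hAu]
    simp [← hmap]
  choose ε hε ρ hρ using fun i => h.local_copy (Φ.ratio_pos i) (Φ.ratio_lt_one i)
    (fun x hx => (hA _).2 ⟨i, x, hx, rfl⟩)
  obtain ⟨δ, hδ, hδε⟩ : ∃ δ > 0, ∀ i, δ ≤ ε i := by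
    have : ∀ᶠ δ in 𝓝[>] (0 : ℝ), ∀ i, δ ≤ ε i :=
      eventually_all.2 fun i =>
        nhdsWithin_le_nhds ((eventually_lt_nhds (hε i)).mono fun _ => le_of_lt)
    exact ((eventually_mem_nhdsWithin (a := (0 : ℝ)) (s := Ioi 0)).and this).exists
  refine h.not_locally_covered hne hδ ρ fun z hz hzδ => ?_
  obtain ⟨i, x, hx, e⟩ := (hA _).1 ((h.add_mul_mem_iff (h.sub_B hz).1).2 hz)
  exact ⟨i, hρ i z hz (hzδ.trans_le (hδε i)) ⟨x, hx, e.symm⟩⟩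

end TwoPieceSystem

/-! ### The two-vertex system -/

/-- Two nonempty compact sets satisfying the two-vertex equations have convex hull `[0, 1]`. -/
theorem TwoPieceSystem.of_isCompact {a b c d : ℝ} {A B : Set ℝ} (ha : 0 < a) (hb : 0 < b)
    (hc : 0 < c) (hd : 0 < d) (hab : a + b < 1) (hcd : c + d < 1) (hA : IsCompact A)
    (hB : IsCompact B) (hA0 : A.Nonempty) (hB0 : B.Nonempty)
    (mem_A : ∀ x, x ∈ A ↔ (∃ y ∈ A, x = a * y) ∨ ∃ y ∈ B, x = 1 - b + b * y)
    (mem_B : ∀ x, x ∈ B ↔ (∃ y ∈ B, x = c * y) ∨ ∃ y ∈ A, x = 1 - d + d * y) :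
    TwoPieceSystem a b c d A B := by
  have hlow : ∃ x ∈ A ∪ B, ∀ y ∈ A ∪ B, x ≤ y :=
    (hA.union hB).exists_isLeast hA0.inl
  have hupp : ∃ x ∈ A ∪ B, ∀ y ∈ A ∪ B, y ≤ x :=
    (hA.union hB).exists_isGreatest hA0.inl
  have hge : ∀ y ∈ A ∪ B, 0 ≤ y := by
    obtain ⟨x, hx, hmin⟩ := hlow
    have hx0 : 0 ≤ x := by
      rcases hx with hx | hx
      · rcases (mem_A x).1 hx with ⟨y, hy, e⟩ | ⟨y, hy, e⟩
        · nlinarith [hmin y (Or.inl hy)]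
        · nlinarith [hmin y (Or.inr hy)]
      · rcases (mem_B x).1 hx with ⟨y, hy, e⟩ | ⟨y, hy, e⟩
        · nlinarith [hmin y (Or.inr hy)]
        · nlinarith [hmin y (Or.inl hy)]
    exact fun y hy => hx0.trans (hmin y hy)
  have hle : ∀ y ∈ A ∪ B, y ≤ 1 := by
    obtain ⟨x, hx, hmax⟩ := hupp
    have hx1 : x ≤ 1 := by
      rcases hx with hx | hx
      · rcases (mem_A x).1 hx with ⟨y, hy, e⟩ | ⟨y, hy, e⟩
        · nlinarith [hmax y (Or.inl hy)]
        · nlinarith [hmax y (Or.inr hy)]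
      · rcases (mem_B x).1 hx with ⟨y, hy, e⟩ | ⟨y, hy, e⟩
        · nlinarith [hmax y (Or.inr hy)]
        · nlinarith [hmax y (Or.inl hy)]
    exact fun y hy => (hmax y hy).trans hx1
  have zero : ∀ {r : ℝ} {X : Set ℝ}, 0 < r → r < 1 → IsCompact X → X.Nonempty →
      (∀ x ∈ X, r * x ∈ X) → (0 : ℝ) ∈ X := by
    rintro r X hr0 hr1 hX ⟨x, hx⟩ hmul
    have hlim := (tendsto_pow_atTop_nhds_zero_of_lt_one hr0.le hr1).mul_const x
    rw [zero_mul] at hlim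
    refine hX.isClosed.mem_of_tendsto hlim (Eventually.of_forall fun n => ?_)
    induction n with
    | zero => simpa using hx
    | succ n ih =>
      rw [pow_succ', mul_assoc]
      exact hmul _ ih
  have one : ∀ {b d : ℝ} {A B : Set ℝ}, 0 < b → b < 1 → 0 < d → d < 1 → IsCompact A →
      A.Nonempty → (∀ y ∈ B, 1 - b + b * y ∈ A) → (∀ y ∈ A, 1 - d + d * y ∈ B) →
      (1 : ℝ) ∈ A := by
    intro b d A B hb hb1 hd hd1 hA hA0 hBA hAB
    have h0 : (0 : ℝ) ∈ (fun x => 1 - x) '' A := by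
      refine zero (r := b * d) (by positivity) (by nlinarith) (hA.image (by fun_prop))
        (hA0.image _) ?_
      rintro _ ⟨x, hx, rfl⟩
      exact ⟨_, hBA _ (hAB x hx), by ring⟩
    obtain ⟨x, hx, e⟩ := h0
    rwa [← sub_eq_zero.1 e] at hx
  have hAA : ∀ y ∈ A, a * y ∈ A := fun y hy => (mem_A _).2 (Or.inl ⟨y, hy, rfl⟩)
  have hBB : ∀ y ∈ B, c * y ∈ B := fun y hy => (mem_B _).2 (Or.inl ⟨y, hy, rfl⟩)
  have hBA : ∀ y ∈ B, 1 - b + b * y ∈ A := fun y hy => (mem_A _).2 (Or.inr ⟨y, hy, rfl⟩)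
  have hAB : ∀ y ∈ A, 1 - d + d * y ∈ B := fun y hy => (mem_B _).2 (Or.inr ⟨y, hy, rfl⟩)
  exact ⟨ha, hb, hc, hd, hab, hcd, hA.isClosed, hB.isClosed,
    fun x hx => ⟨hge x (Or.inl hx), hle x (Or.inl hx)⟩,
    fun x hx => ⟨hge x (Or.inr hx), hle x (Or.inr hx)⟩,
    zero ha (by linarith) hA hA0 hAA, zero hc (by linarith) hB hB0 hBB,
    one hb (by linarith) hd (by linarith) hA hA0 hBA hAB,
    one hd (by linarith) hb (by linarith) hB hB0 hAB hBA, mem_A, mem_B⟩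

theorem TwoVertexParams.twoPieceSystem (P : TwoVertexParams) {F : TwoVertex → Set ℝ}
    (hF : P.toIFS.IsAttractor F) :
    TwoPieceSystem P.a P.b P.c P.d (F TwoVertex.u) (F TwoVertex.v) := by
  have hu : P.a + P.gu = 1 - P.b := by linarith [P.sum_u]
  have hv : P.c + P.gv = 1 - P.d := by linarith [P.sum_v]
  refine .of_isCompact P.a_pos P.b_pos P.c_pos P.d_pos (by linarith [P.gu_pos])
    (by linarith [P.gv_pos]) (hF.1 _).2 (hF.1 _).2 (hF.1 _).1 (hF.1 _).1 (fun x => ?_) (fun x => ?_)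
  · conv_lhs => rw [hF.2 .u]
    simp only [mem_iUnion, mem_image, mem_ofPred_eq]
    constructor
    · rintro ⟨e, he, y, hy, rfl⟩
      cases e
      · exact Or.inl ⟨y, hy, add_zero _⟩
      · exact Or.inr ⟨y, hy, by rw [← hu]; exact add_comm _ _⟩
      · cases he
      · cases he
    · rintro (⟨y, hy, rfl⟩ | ⟨y, hy, rfl⟩)
      · exact ⟨.e₁, rfl, y, hy, add_zero _⟩
      · exact ⟨.e₂, rfl, y, hy, by rw [← hu]; exact add_comm _ _⟩
  · conv_lhs => rw [hF.2 .v]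
    simp only [mem_iUnion, mem_image, mem_ofPred_eq]
    constructor
    · rintro ⟨e, he, y, hy, rfl⟩
      cases e
      · cases he
      · cases he
      · exact Or.inl ⟨y, hy, add_zero _⟩
      · exact Or.inr ⟨y, hy, by rw [← hv]; exact add_comm _ _⟩
    · rintro (⟨y, hy, rfl⟩ | ⟨y, hy, rfl⟩)
      · exact ⟨.e₃, rfl, y, hy, add_zero _⟩
      · exact ⟨.e₄, rfl, y, hy, by rw [← hv]; exact add_comm _ _⟩

/-- If the two components of the attractor of the `2`-vertex system differ, then neither of them is
the attractor of a standard IFS on `ℝ`, with or without separation conditions. -/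
theorem mainTheorem1 (P : TwoVertexParams) (F : TwoVertex → Set ℝ)
    (hF : P.toIFS.IsAttractor F) (hne : F TwoVertex.u ≠ F TwoVertex.v) :
    ¬ IsStandardIFSAttractor (F TwoVertex.u) ∧ ¬ IsStandardIFSAttractor (F TwoVertex.v) :=
  ⟨(P.twoPieceSystem hF).not_isStandardIFSAttractor hne,
    (P.twoPieceSystem hF).swap.not_isStandardIFSAttractor hne.symm⟩
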